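/- Let $k$, $n$ and $t$ be positive integers with $t \ge 303\, n \log_2 n$. Let $G$ be a simple graph on $n$ vertices, and let $c : E(G) \to \{1, \dots, t\}$ be an edge colouring (not necessarily proper) such that $|c^{-1}(i)| \ge k$ for every $i \in \{1, \dots, t\}$. Then $G$ contains a rainbow cycle of length at most $\lceil n/k \rceil$, that is, a cycle $C$ of $G$ with at most $\lceil n/k \rceil$ edges such that $c(e) \ne c(f)$ for all distinct edges $e, f$ of $C$. -/

import Mathlib

/-- A closed walk `p` of `G` is a *rainbow cycle* with respect to the edge colouring `c` if it is a
cycle and any two distinct edges of it have different colours. -/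
def SimpleGraph.Walk.IsRainbowCycle {V C : Type*} {G : SimpleGraph V} (c : G.edgeSet → C) {v : V}
    (p : G.Walk v v) : Prop :=
  p.IsCycle ∧ ∀ e f : G.edgeSet, (e : Sym2 V) ∈ p.edges → (f : Sym2 V) ∈ p.edges → e ≠ f → c e ≠ c f

/-! One edge of each colour gives a rainbow subgraph with t > 2n edges, so a short cycle in it
suffices. Counting edges gives tk ≤ n², hence n/k ≥ t/n ≥ 303 log₂ n, which exceeds the length
2⌊log₂ n⌋ + 3 needed. For the short cycle, suppose there is none. Balls cannot double at every
radius, so some ball has at most twice as many vertices after one more step. The larger ball spans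
no more edges than vertices, since a non-tree edge would close a short cycle. Delete the smaller
ball, charging two edges to each of its vertices, and induct. -/

open Finset in
/-- In a graph without cycles of length at most `2 * R + 1`, a set `B` of vertices at distance at
most `R` from `v` spans at most `#B` edges. -/
theorem SimpleGraph.card_edges_le_card_of_dist_le {V : Type*} (G : SimpleGraph V) (v : V) (R : ℕ)
    (hg : ∀ (u : V) (p : G.Walk u u), p.IsCycle → 2 * R + 1 < p.length)
    (B : Finset V) (hB : ∀ x ∈ B, G.Reachable v x ∧ G.dist v x ≤ R)
    (E : Finset (Sym2 V)) (hE : ∀ e ∈ E, e ∈ G.edgeSet ∧ ∀ x ∈ e, x ∈ B) :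
    #E ≤ #B := by
  classical
  have hparent : ∀ z, ∃ w, G.Reachable v z → z ≠ v →
      G.Adj z w ∧ G.Reachable v w ∧ G.dist v w + 1 = G.dist v z := by
    intro z
    by_cases hz : G.Reachable v z ∧ z ≠ v
    · obtain ⟨hr, hne⟩ := hz
      obtain ⟨q, hq⟩ := hr.symm.exists_walk_length_eq_dist
      cases q with
      | nil => exact absurd rfl hne
      | @cons _ w _ h q =>
        refine ⟨w, fun _ _ => ⟨h, q.reachable.symm, ?_⟩⟩
        rw [SimpleGraph.Walk.length_cons, G.dist_comm] at hq
        have h1 : G.dist v w ≤ q.length := by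
          rw [G.dist_comm]; exact SimpleGraph.dist_le q
        obtain ⟨q', hq'⟩ := q.reachable.exists_walk_length_eq_dist
        have h2 : G.dist z v ≤ (SimpleGraph.Walk.cons h q').length := SimpleGraph.dist_le _
        rw [SimpleGraph.Walk.length_cons, hq', G.dist_comm, G.dist_comm (u := w)] at h2
        omega
    · exact ⟨z, fun h1 h2 => absurd ⟨h1, h2⟩ hz⟩
  choose par hpar using hparent
  -- A breadth-first tree rooted at `v`.
  let P : SimpleGraph V :=
    { Adj := fun a b => G.Adj a b ∧ ((a ≠ v ∧ par a = b) ∨ (b ≠ v ∧ par b = a))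
      symm := ⟨fun a b h => ⟨h.1.symm, h.2.symm⟩⟩
      loopless := ⟨fun a h => G.loopless.irrefl a h.1⟩ }
  have hPG : P ≤ G := fun a b h => h.1
  have hwalk : ∀ d z, G.Reachable v z → G.dist v z = d → ∃ p : P.Walk z v, p.length = d := by
    intro d
    induction d with
    | zero =>
      intro z hr hd
      obtain rfl := (hr.dist_eq_zero_iff).1 hd
      exact ⟨.nil, rfl⟩
    | succ d ih =>
      intro z hr hd
      have hne : z ≠ v := by
        rintro rfl
        simp at hd
      obtain ⟨h1, h2, h3⟩ := hpar z hr hne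
      obtain ⟨p, hp⟩ := ih (par z) h2 (by omega)
      have hadj : P.Adj z (par z) := ⟨h1, Or.inl ⟨hne, rfl⟩⟩
      exact ⟨.cons hadj p, by simp [hp]⟩
  have hEP : ∀ e ∈ E, e ∈ P.edgeSet := by
    intro e he
    obtain ⟨heG, heB⟩ := hE e he
    induction e with
    | _ x y =>
    by_contra hnot
    obtain ⟨hxr, hxd⟩ := hB x (heB x (Sym2.mem_mk_left x y))
    obtain ⟨hyr, hyd⟩ := hB y (heB y (Sym2.mem_mk_right x y))
    obtain ⟨p, hp⟩ := hwalk _ x hxr rfl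
    obtain ⟨q, hq⟩ := hwalk _ y hyr rfl
    have hadj : G.Adj x y := heG
    -- The tree path through the root has length at most 2R; a non-tree edge xy closes it into a
    -- cycle of length at most 2R + 1.
    let w : P.Walk y x := (q.append p.reverse).bypass
    have hw : w.IsPath := SimpleGraph.Walk.bypass_isPath _
    have hwl : w.length ≤ 2 * R := by
      refine (SimpleGraph.Walk.length_bypass_le_length _).trans ?_
      rw [SimpleGraph.Walk.length_append, SimpleGraph.Walk.length_reverse]
      omega
    have hcyc : (SimpleGraph.Walk.cons hadj (w.mapLe hPG)).IsCycle := by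
      rw [SimpleGraph.Walk.cons_isCycle_iff]
      refine ⟨hw.mapLe hPG, ?_⟩
      rw [SimpleGraph.Walk.edges_mapLe_eq_edges]
      exact fun h => hnot (w.edges_subset_edgeSet h)
    have := hg _ _ hcyc
    rw [SimpleGraph.Walk.length_cons, SimpleGraph.Walk.length_map] at this
    omega
  -- Each tree edge is charged to its child endpoint.
  have hsub : E ⊆ B.image (fun z => s(z, par z)) := by
    intro e he
    have heP := hEP e he
    obtain ⟨-, heB⟩ := hE e he
    induction e with
    | _ x y =>
    rw [mem_image]
    obtain ⟨-, ⟨-, h⟩ | ⟨-, h⟩⟩ := (show P.Adj x y from heP)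
    · exact ⟨x, heB x (Sym2.mem_mk_left x y), by rw [h]⟩
    · exact ⟨y, heB y (Sym2.mem_mk_right x y), by rw [h, Sym2.eq_swap]⟩
  exact (card_le_card hsub).trans card_image_le

open Finset in
/-- A graph without cycles of length at most `2 * R + 1`, all of whose edges lie in a set `S` of
fewer than `2 ^ R` vertices, has at most `2 * #S` edges. -/
theorem SimpleGraph.card_edges_le_two_mul_of_forall_isCycle {V : Type*} (R : ℕ) (S : Finset V)
    (hS : #S < 2 ^ R) (G : SimpleGraph V)
    (hg : ∀ (u : V) (p : G.Walk u u), p.IsCycle → 2 * R + 1 < p.length)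
    (E : Finset (Sym2 V)) (hE : ∀ e, e ∈ E ↔ e ∈ G.edgeSet) (hES : ∀ e ∈ E, ∀ x ∈ e, x ∈ S) :
    #E ≤ 2 * #S := by
  classical
  induction S using Finset.strongInduction generalizing G E with
  | H S ih =>
  obtain rfl | ⟨v, hv⟩ := S.eq_empty_or_nonempty
  · have : E = ∅ := by
      refine eq_empty_of_forall_notMem fun e he => ?_
      induction e with
      | _ x y => simpa using hES _ he x (Sym2.mem_mk_left x y)
    simp [this]
  -- Reachability must be required, as `dist` is 0 between disconnected vertices.
  let B : ℕ → Finset V := fun r => S.filter fun x => G.Reachable v x ∧ G.dist v x ≤ r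
  have hmemB : ∀ r x, x ∈ B r ↔ x ∈ S ∧ G.Reachable v x ∧ G.dist v x ≤ r := fun r x => by
    simp [B]
  have hBS : ∀ r, B r ⊆ S := fun r => filter_subset _ _
  have hvB : ∀ r, v ∈ B r := fun r => (hmemB r v).2 ⟨hv, .refl v, by simp⟩
  -- Otherwise `B R` would have at least 2^R > #S elements.
  obtain ⟨r, hrR, hr⟩ : ∃ r < R, #(B (r + 1)) ≤ 2 * #(B r) := by
    by_contra! hcon
    have hgrow : ∀ r ≤ R, 2 ^ r ≤ #(B r) := by
      intro r
      induction r with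
      | zero => exact fun _ => card_pos.2 ⟨v, hvB 0⟩
      | succ r ihr =>
        intro h
        have := hcon r (by omega)
        have := ihr (by omega)
        rw [pow_succ]
        omega
    have := hgrow R le_rfl
    have := card_le_card (hBS R)
    omega
  let G' : SimpleGraph V :=
    { Adj := fun a b => G.Adj a b ∧ a ∉ B r ∧ b ∉ B r
      symm := ⟨fun a b h => ⟨h.1.symm, h.2.2, h.2.1⟩⟩
      loopless := ⟨fun a h => G.loopless.irrefl a h.1⟩ }
  have hGG : G' ≤ G := fun a b h => h.1
  have hss : S \ B r ⊂ S := sdiff_ssubset (hBS r) ⟨v, hvB r⟩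
  have hfar : #(E.filter fun e => ∀ x ∈ e, x ∉ B r) ≤ 2 * #(S \ B r) := by
    refine ih _ hss ((card_le_card hss.subset).trans_lt hS) G' ?_ _ ?_ ?_
    · intro u p hp
      simpa using hg u (p.mapLe hGG) (hp.mapLe hGG)
    · intro e
      rw [mem_filter, hE]
      induction e with
      | _ x y => simp [G']
    · intro e he x hx
      rw [mem_filter] at he
      exact mem_sdiff.2 ⟨hES e he.1 x hx, he.2 x hx⟩
  -- An edge meeting `B r` lies inside `B (r + 1)`, and r + 1 ≤ R keeps the bound on cycle lengths
  -- applicable.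
  have hnear : #(E.filter fun e => ¬ ∀ x ∈ e, x ∉ B r) ≤ #(B (r + 1)) := by
    refine G.card_edges_le_card_of_dist_le v (r + 1) (fun u p hp => ?_) _
      (fun x hx => ((hmemB _ x).1 hx).2) _ ?_
    · have := hg u p hp
      omega
    · intro e he
      rw [mem_filter] at he
      obtain ⟨heE, hex⟩ := he
      refine ⟨(hE e).1 heE, ?_⟩
      push Not at hex
      obtain ⟨x, hx, hxB⟩ := hex
      obtain ⟨y, rfl⟩ := Sym2.mem_iff_exists.1 hx
      have hadj : G.Adj x y := (hE _).1 heE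
      obtain ⟨hxS, hxr, hxd⟩ := (hmemB r x).1 hxB
      intro z hz
      refine (hmemB _ z).2 ⟨hES _ heE z hz, ?_⟩
      obtain rfl | rfl := Sym2.mem_iff.1 hz
      · exact ⟨hxr, by omega⟩
      · obtain ⟨q, hq⟩ := hxr.exists_walk_length_eq_dist
        have := SimpleGraph.dist_le (q.concat hadj)
        rw [SimpleGraph.Walk.length_concat] at this
        exact ⟨(q.concat hadj).reachable, by omega⟩
  have h1 := card_filter_add_card_filter_not (s := E) fun e => ∀ x ∈ e, x ∉ B r
  have h2 := card_sdiff_add_card_eq_card (hBS r)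
  omega

open Finset in
/-- A graph on `n` vertices with more than `2 * n` edges has a cycle of length at most
`2 * Nat.log 2 n + 3`. -/
theorem SimpleGraph.exists_isCycle_length_le_of_two_mul_card_lt {V : Type*} [Fintype V]
    (G : SimpleGraph V) [Fintype G.edgeSet] (h : 2 * Fintype.card V < #G.edgeFinset) :
    ∃ (u : V) (p : G.Walk u u), p.IsCycle ∧ p.length ≤ 2 * Nat.log 2 (Fintype.card V) + 3 := by
  by_contra! hcon
  have := SimpleGraph.card_edges_le_two_mul_of_forall_isCycle (Nat.log 2 (Fintype.card V) + 1)
    (univ : Finset V) (Nat.lt_pow_succ_log_self (by norm_num) _) G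
    (fun u p hp => by have := hcon u p hp; omega) G.edgeFinset (fun e => by simp) (by simp)
  rw [card_univ] at this
  omega

/-- A graph on `n` vertices whose edges are coloured with more than `2 * n` colours, all of them
used, has a rainbow cycle of length at most `2 * Nat.log 2 n + 3`. -/
theorem SimpleGraph.exists_isRainbowCycle_length_le {V C : Type*} [Fintype V] [Fintype C]
    (G : SimpleGraph V) (c : G.edgeSet → C) (hc : Function.Surjective c)
    (h : 2 * Fintype.card V < Fintype.card C) :
    ∃ (v : V) (p : G.Walk v v),
      p.IsRainbowCycle c ∧ p.length ≤ 2 * Nat.log 2 (Fintype.card V) + 3 := by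
  classical
  choose e he using hc
  have hinj : Function.Injective fun i => (e i : Sym2 V) := by
    intro i j hij
    rw [← he i, ← he j, Subtype.ext hij]
  let H : SimpleGraph V := SimpleGraph.fromEdgeSet (Set.range fun i => (e i : Sym2 V))
  have hedge : H.edgeSet = Set.range fun i => (e i : Sym2 V) := by
    rw [SimpleGraph.edgeSet_fromEdgeSet, sdiff_eq_left, Set.disjoint_left]
    rintro _ ⟨i, rfl⟩ hd
    exact G.not_isDiag_of_mem_edgeSet (e i).2 hd
  have hHG : H ≤ G := by
    rw [← SimpleGraph.edgeSet_subset_edgeSet, hedge]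
    rintro _ ⟨i, rfl⟩
    exact (e i).2
  have hcard : H.edgeFinset.card = Fintype.card C := by
    rw [SimpleGraph.edgeFinset, ← Set.ncard_eq_toFinset_card', hedge,
      ← Set.image_univ, Set.ncard_image_of_injective _ hinj,
      Set.ncard_univ, Nat.card_eq_fintype_card]
  obtain ⟨u, p, hp, hl⟩ := H.exists_isCycle_length_le_of_two_mul_card_lt (by rwa [hcard])
  have hrep : ∀ f : G.edgeSet, (f : Sym2 V) ∈ (p.mapLe hHG).edges → ∃ i, e i = f := by
    intro f hf
    rw [SimpleGraph.Walk.edges_mapLe_eq_edges] at hf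
    have := p.edges_subset_edgeSet hf
    rw [hedge] at this
    obtain ⟨i, hi⟩ := this
    exact ⟨i, Subtype.ext hi⟩
  refine ⟨u, p.mapLe hHG, ⟨hp.mapLe hHG, fun f g hf hg hne => ?_⟩, by simpa using hl⟩
  obtain ⟨i, rfl⟩ := hrep f hf
  obtain ⟨j, rfl⟩ := hrep g hg
  rw [he, he]
  exact fun hij => hne (by rw [hij])

/-- If every one of the `t` colour classes of an edge colouring of a graph on `n` vertices has at
least `k` edges, then `t * k ≤ n.choose 2`. -/
theorem SimpleGraph.mul_le_choose_two_of_le_ncard_preimage {V : Type*} [Fintype V]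
    (G : SimpleGraph V) {t k : ℕ} (c : G.edgeSet → Fin t)
    (hc : ∀ i : Fin t, k ≤ (c ⁻¹' {i}).ncard) :
    t * k ≤ (Fintype.card V).choose 2 := by
  classical
  refine le_trans ?_ G.card_edgeFinset_le_card_choose_two
  rw [SimpleGraph.edgeFinset_card, ← Finset.card_univ,
    Finset.card_eq_sum_card_fiberwise (f := c) (t := Finset.univ) (fun _ _ => Finset.mem_univ _)]
  refine le_trans (by simp) (Finset.card_nsmul_le_sum Finset.univ _ k fun i _ => ?_)
  refine (hc i).trans_eq ?_
  rw [← Set.ncard_coe_finset]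
  congr 1
  ext f
  simp

theorem corollary2p2 {V : Type*} [Fintype V] (G : SimpleGraph V) (n k t : ℕ)
    (hn : Fintype.card V = n) (hk : 0 < k) (ht : 0 < t)
    (htn : 303 * (n : ℝ) * Real.logb 2 (n : ℝ) ≤ (t : ℝ))
    (c : G.edgeSet → Fin t) (hc : ∀ i : Fin t, k ≤ (c ⁻¹' {i}).ncard) :
    ∃ (v : V) (p : G.Walk v v), p.IsRainbowCycle c ∧ p.length ≤ ⌈(n : ℚ) / (k : ℚ)⌉₊ := by
  have hcount := G.mul_le_choose_two_of_le_ncard_preimage c hc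
  rw [hn] at hcount
  have hn2 : 2 ≤ n := by
    by_contra! hlt
    rw [Nat.choose_eq_zero_of_lt hlt] at hcount
    exact absurd hcount (Nat.mul_pos ht hk).not_ge
  have hsq : t * k ≤ n * n := by
    refine hcount.trans ((Nat.choose_le_pow n 2).trans_eq (sq n))
  have hlog1 : 1 ≤ Nat.log 2 n := Nat.log_pos (by norm_num) hn2
  have hlog : (Nat.log 2 n : ℝ) ≤ Real.logb 2 n := by
    exact_mod_cast Real.natLog_le_logb n 2
  have htlog : 303 * n * Nat.log 2 n ≤ t := by
    have : 303 * (n : ℝ) * Nat.log 2 n ≤ t := by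
      refine le_trans ?_ htn
      gcongr
    exact_mod_cast this
  have htn2 : 2 * n < t := by nlinarith
  have hsurj : Function.Surjective c := by
    intro i
    obtain ⟨f, hf⟩ := Set.nonempty_of_ncard_ne_zero (hk.trans_le (hc i)).ne'
    exact ⟨f, hf⟩
  obtain ⟨v, p, hp, hl⟩ := G.exists_isRainbowCycle_length_le c hsurj (by simpa [hn] using htn2)
  rw [hn] at hl
  refine ⟨v, p, hp, hl.trans ?_⟩
  -- With L = `Nat.log 2 n` ≥ 1, 2L + 3 ≤ 5L ≤ 303L, so the constant 303 leaves ample room.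
  have hmul : (2 * Nat.log 2 n + 3) * k ≤ n := by
    have h1 : n * (303 * Nat.log 2 n * k) ≤ n * n := by
      refine le_trans ?_ hsq
      calc n * (303 * Nat.log 2 n * k) = 303 * n * Nat.log 2 n * k := by ring
        _ ≤ t * k := Nat.mul_le_mul_right k htlog
    refine le_trans (Nat.mul_le_mul_right k ?_) (Nat.le_of_mul_le_mul_left h1 (by omega))
    omega
  have hle : ((2 * Nat.log 2 n + 3 : ℕ) : ℚ) ≤ (n : ℚ) / k := by
    rw [le_div_iff₀ (by exact_mod_cast hk)]
    exact_mod_cast hmul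
  exact_mod_cast hle.trans (Nat.le_ceil _)
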